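/- Notation. Let $d\in\mathbb N$ and equip $\mathbb{R}^d$ with its Euclidean norm; "smooth" means $C^2$. For $A\subset\mathbb{R}^d$ write $d_A(x)=\inf_{a\in A}\|x-a\|$ (with $\inf\emptyset=+\infty$). For $X\subset\mathbb{R}^d$ put $\overline{\complement} X=\overline{\mathbb{R}^d\setminus X}$ and, for $r>0$, $X^{-r}=\{x : d_{\overline{\complement} X}(x)\ge r\}$. The Clarke gradient $\partial^*\varphi(x)$ of a locally Lipschitz $\varphi:\mathbb{R}^d\to\mathbb{R}$ is the convex hull of all limits $\lim_n\nabla\varphi(x_n)$ with $x_n\to x$ and $\varphi$ differentiable at each $x_n$. For $\mu\in(0,1]$, $\mathrm{reach}_\mu(X)$ is the supremum of the $s\geq 0$ such that every element of $\partial^* d_X(x)$ has norm at least $\mu$ whenever $0<d_X(x)\le s$. The number $\mathrm{reach}(A)$ is the supremum of the $t \geq 0$ such that every $x$ with $d_A(x)<t$ has a unique closest point in $A$. A compact set $X\subset\mathbb{R}^d$ is *complementary regular* if $\overline{\mathrm{int}\,X}=X$, $\mathrm{reach}_\mu(X)>0$ for some $\mu\in(0,1]$, and $\mathrm{reach}(\overline{\complement}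 X)>0$. For $x\in A$, $\mathrm{Tan}(A,x)$ is the cone generated by the limits of $\frac{x_n-x}{\|x_n-x\|}$ with $x_n\in A\setminus\{x\}$, $x_n\to x$. For $X$ complementary regular, let $\mathrm{Nor}(X,x)=-\{u:\langle u,b\rangle\le 0\ \ \forall b\in \mathrm{Tan}(\overline{\complement} X,x)\}$ if $x\in\partial X$ and $\mathrm{Nor}(X,x)=\{0\}$ if $x$ is an interior point of $X$. Given $f:\mathbb{R}^d\to\mathbb{R}$ of class $C^2$, a point $x\in X$ is a *critical point* of $f_{|X}$ if $\nabla f(x)\in-\mathrm{Nor}(X,x)$, and $c\in\mathbb{R}$ is a *regular value* of $f_{|X}$ if $f^{-1}(c)$ contains no critical point of $f_{|X}$. Statement (homotopy equivalence). Let $X\subset\mathbb{R}^d$ be complementary regular, let $f:\mathbb{R}^d\to\mathbb{R}$ be $C^2$, let $c$ be a regular value of $f_{|X}$, and let $\eta:\mathbb{R}^d\to\mathbb{R}^d$ be $C^2$ with $\|\eta(x)\|\le 1$ for all $x$. Put $f_r(x)=f(x+r\eta(x))$. Then there is $r_0>0$ such that for all $0<r<r_0$ the set $X^{-r}\cap f_r^{-1}(-\infty,c]$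 is homotopy equivalent to $X_c=X\cap f^{-1}(-\infty,c]$ (both with the topology induced by $\mathbb{R}^d$). -/

import Mathlib

open Set Filter Topology

open scoped ENNReal

noncomputable section

namespace ComplReg

variable {d : ℕ}

/-- The complement set of `X`: the closure of the set-theoretic complement. -/
def cl_compl (X : Set (EuclideanSpace ℝ (Fin d))) : Set (EuclideanSpace ℝ (Fin d)) :=
  closure Xᶜ

/-- The counter-offset `X^{-r}`, the set of points at distance at least `r` from the complement set.
The distance is extended-real-valued, so that the distance to the empty set is `∞`. -/
def counterOffset (X : Set (EuclideanSpace ℝ (Fin d))) (r : ℝ) :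
    Set (EuclideanSpace ℝ (Fin d)) :=
  {x | ENNReal.ofReal r ≤ Metric.infEDist x (cl_compl X)}

/-- The Clarke gradient of `φ` at `x`: the convex hull of the limits of `∇ φ (u n)` along
sequences `u n → x` of points of differentiability of `φ`. -/
def clarke (φ : EuclideanSpace ℝ (Fin d) → ℝ) (x : EuclideanSpace ℝ (Fin d)) :
    Set (EuclideanSpace ℝ (Fin d)) :=
  convexHull ℝ {v | ∃ u : ℕ → EuclideanSpace ℝ (Fin d), Tendsto u atTop (𝓝 x) ∧
    (∀ n, DifferentiableAt ℝ φ (u n)) ∧ Tendsto (fun n => gradient φ (u n)) atTop (𝓝 v)}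

/-- `Δ(A)`, the infimum of the norms of the elements of `A`. -/
def minNorm (A : Set (EuclideanSpace ℝ (Fin d))) : ℝ := Metric.infDist 0 A

/-- The `μ`-reach of `X`: the supremum of the `s` such that `Δ(∂* d_X (x)) ≥ μ` at every point `x`
with `0 < d_X(x) ≤ s`. -/
def muReach (μ : ℝ) (X : Set (EuclideanSpace ℝ (Fin d))) : ℝ≥0∞ :=
  sSup {s | ∀ x, 0 < Metric.infEDist x X → Metric.infEDist x X ≤ s →
    μ ≤ minNorm (clarke (fun y => Metric.infDist y X) x)}

/-- The reach of `A`: the largest `t` such that every point at distance less than `t`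
from `A` has a unique closest point in `A`. -/
def reach (A : Set (EuclideanSpace ℝ (Fin d))) : ℝ≥0∞ :=
  sSup {t | ∀ x, Metric.infEDist x A < t → ∃! a, a ∈ A ∧ dist x a = Metric.infDist x A}

/-- Complementary regular sets. -/
structure IsComplementaryRegular (X : Set (EuclideanSpace ℝ (Fin d))) : Prop where
  isCompact : IsCompact X
  closure_interior : closure (interior X) = X
  muReach_pos : ∃ μ : ℝ, 0 < μ ∧ μ ≤ 1 ∧ 0 < muReach μ X
  reach_compl_pos : 0 < reach (cl_compl X)

/-- The polar cone `{u | ⟪u, b⟫ ≤ 0 for all b ∈ B}`. -/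
def polarCone (B : Set (EuclideanSpace ℝ (Fin d))) : Set (EuclideanSpace ℝ (Fin d)) :=
  {u | ∀ b ∈ B, inner ℝ u b ≤ 0}

/-- The polar of the (one-sided) tangent cone; this is the normal cone of a set
with positive reach. -/
def tangentPolar (A : Set (EuclideanSpace ℝ (Fin d))) (x : EuclideanSpace ℝ (Fin d)) :
    Set (EuclideanSpace ℝ (Fin d)) :=
  polarCone (posTangentConeAt A x)

open Classical in
/-- The normal cone, at a point `x` of `X`, of a set `X` whose complement set has positive reach.
At boundary points it is the opposite of the normal cone of the complement set; at interior
points (where the tangent cone of `X` is the whole space) it is `{0}`. -/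
def normalCone (X : Set (EuclideanSpace ℝ (Fin d))) (x : EuclideanSpace ℝ (Fin d)) :
    Set (EuclideanSpace ℝ (Fin d)) :=
  if x ∈ frontier X then {v | -v ∈ tangentPolar (cl_compl X) x} else {0}

/-- `x` is a critical point of `f` restricted to `X`: `x ∈ X` and `∇ f (x) ∈ -Nor(X, x)`. -/
def IsCriticalPt (f : EuclideanSpace ℝ (Fin d) → ℝ) (X : Set (EuclideanSpace ℝ (Fin d)))
    (x : EuclideanSpace ℝ (Fin d)) : Prop :=
  x ∈ X ∧ -gradient f x ∈ normalCone X x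

/-- `c` is a regular value of `f` restricted to `X`: no critical point has value `c`. -/
def IsRegularValue (f : EuclideanSpace ℝ (Fin d) → ℝ) (X : Set (EuclideanSpace ℝ (Fin d)))
    (c : ℝ) : Prop :=
  ∀ x, f x = c → ¬ IsCriticalPt f X x

/-- `f_r : x ↦ f (x + r η(x))`. -/
def shifted (f : EuclideanSpace ℝ (Fin d) → ℝ)
    (η : EuclideanSpace ℝ (Fin d) → EuclideanSpace ℝ (Fin d)) (r : ℝ) :
    EuclideanSpace ℝ (Fin d) → ℝ :=
  fun x => f (x + r • η x)

/-- The sublevel set `X_c = X ∩ f⁻¹(-∞, c]`. -/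
def sublevel (X : Set (EuclideanSpace ℝ (Fin d))) (f : EuclideanSpace ℝ (Fin d) → ℝ) (c : ℝ) :
    Set (EuclideanSpace ℝ (Fin d)) :=
  X ∩ f ⁻¹' Iic c

end ComplReg

end

/-!
Let `Y` be the closure of the complement of `X`. If `Y` has positive reach, the segments from a
point to its projections on `Y` point along proximal normals of a fixed radius `τ`: they extend to
radii of balls of radius `τ` contained in `X`.

At a boundary point of `X`, all these normals lie in an open half-space `{n | 0 < ⟪v, n⟫}`. Indeed,
if the Clarke gradients of the distance to `X` have norm at least `μ`, this distance grows at rate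
`μ` along suitable displacements leaving `X`, whereas it is at most quadratic in a displacement
making an angle of at most `π / 2` with a proximal normal. If moreover `f x = c`, regularity of `c`
gives some `b` tangent to `Y` with `0 < ⟪∇ f x, b⟫`, and for small `ε` the direction `ε • v - b`
increases the distance to `Y` and decreases `f` to first order.

These conditions on a direction are convex and open, so a partition of unity gives a continuous
field `w` of such directions on `X`. By compactness, the maps `x ↦ x + t • w x` push both sublevel
sets into themselves at a uniform rate; after a time `T` proportional to `r` they send each set into
the other, and `x ↦ x + T • w x` is a homotopy equivalence in both directions.
-/

namespace ComplReg

open Metric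

section DistanceFunction

/-- The projections of `x` on `A`. -/
def closestPoints {E : Type*} [PseudoMetricSpace E] (A : Set E) (x : E) : Set E :=
  {a ∈ A | dist x a = infDist x A}

theorem eventually_forall_closestPoints {E : Type*} [PseudoMetricSpace E] [ProperSpace E]
    {A : Set E} (hA : IsClosed A) {x : E} {P : E → Prop}
    (hP : ∀ p ∈ closestPoints A x, ∀ᶠ q in 𝓝 p, P q) :
    ∀ᶠ y in 𝓝 x, ∀ q ∈ closestPoints A y, P q := by
  have hK : IsCompact (A ∩ closedBall x (infDist x A + 2)) :=
    (isCompact_closedBall _ _).inter_left hA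
  have hloc : ∀ p ∈ A ∩ closedBall x (infDist x A + 2),
      ∀ᶠ z : E × E in 𝓝 (x, p), dist z.1 z.2 = infDist z.1 A → P z.2 := by
    rintro p ⟨hp, -⟩
    rcases (infDist_le_dist_of_mem hp).eq_or_lt' with heq | hlt
    · filter_upwards [continuousAt_snd.eventually (hP p ⟨hp, heq⟩)] with z hz _ using hz
    · have hcont : Continuous fun z : E × E => infDist z.1 A := by fun_prop
      filter_upwards [hcont.continuousAt.eventually_lt continuous_dist.continuousAt hlt] with z hz h
      exact absurd h hz.ne'
  filter_upwards [hK.eventually_forall_of_forall_eventually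
    (P := fun y q => dist y q = infDist y A → P q) hloc, ball_mem_nhds x one_pos] with y hy hyx q hq
  refine hy q ⟨hq.1, mem_closedBall'.2 ?_⟩ hq.2
  have hyA : infDist y A ≤ infDist x A + dist y x := infDist_le_infDist_add_dist
  have := dist_triangle x y q
  rw [hq.2, dist_comm x y] at this
  linarith [mem_ball.1 hyx]

theorem nonempty_of_infDist_pos {E : Type*} [PseudoMetricSpace E] {A : Set E} {x : E}
    (hx : 0 < infDist x A) : A.Nonempty := by
  rw [nonempty_iff_ne_empty]
  rintro rfl
  simp at hx

theorem closestPoints_nonempty {E : Type*} [PseudoMetricSpace E] [ProperSpace E] {A : Set E}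
    (hA : IsClosed A) (hne : A.Nonempty) (x : E) : (closestPoints A x).Nonempty :=
  let ⟨p, hp, hpx⟩ := hA.exists_infDist_eq_dist hne x
  ⟨p, hp, hpx.symm⟩

variable {E : Type*} [NormedAddCommGroup E] [InnerProductSpace ℝ E]

/-- `w` is a direction in which the distance to `A` increases from `z` at rate at least `μ`: it
makes an angle of cosine at least `μ / ‖w‖` with the segments from the projections of `z` to `z`.
The unit vectors pointing away from the projections are the gradients of the distance. -/
def IsAscentDir (A : Set E) (μ : ℝ) (z w : E) : Prop :=
  ∀ p ∈ closestPoints A z, μ * infDist z A ≤ inner ℝ w (z - p)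

theorem norm_inv_infDist_smul_sub {A : Set E} {z p : E} (hz : 0 < infDist z A)
    (hp : p ∈ closestPoints A z) : ‖(infDist z A)⁻¹ • (z - p)‖ = 1 := by
  rw [norm_smul, norm_inv, Real.norm_of_nonneg hz.le, ← dist_eq_norm, hp.2,
    inv_mul_cancel₀ hz.ne']

theorem exists_isAscentDir_one_of_existsUnique {A : Set E} {z : E} (hz : 0 < infDist z A)
    (huniq : ∃! p, p ∈ closestPoints A z) : ∃ w : E, ‖w‖ = 1 ∧ IsAscentDir A 1 z w := by
  obtain ⟨p, hp, hpu⟩ := huniq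
  refine ⟨(infDist z A)⁻¹ • (z - p), norm_inv_infDist_smul_sub hz hp, fun q hq => ?_⟩
  rw [hpu q hq, real_inner_smul_left, real_inner_self_eq_norm_sq, ← dist_eq_norm, hp.2, one_mul,
    sq, inv_mul_cancel_left₀ hz.ne']

variable [ProperSpace E]

theorem IsAscentDir.eventually_add_mul_le_infDist {A : Set E} (hA : IsClosed A) {z w : E}
    {α' α : ℝ} (hw : IsAscentDir A α z w) (hα : α' < α) (hz : 0 < infDist z A) :
    ∀ᶠ t in 𝓝[>] (0 : ℝ), infDist z A + α' * t ≤ infDist (z + t • w) A := by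
  have hnear : ∀ᶠ y in 𝓝 z, ∀ q ∈ closestPoints A y, α' * ‖z - q‖ < inner ℝ w (z - q) := by
    refine eventually_forall_closestPoints hA fun p hp => ?_
    refine ContinuousAt.eventually_lt (by fun_prop) (by fun_prop) ?_
    rw [← dist_eq_norm, hp.2]
    exact (mul_lt_mul_of_pos_right hα hz).trans_le (hw p hp)
  have hline : Tendsto (fun t : ℝ => z + t • w) (𝓝[>] 0) (𝓝 z) :=
    tendsto_nhdsWithin_of_tendsto_nhds (Continuous.tendsto' (by fun_prop) _ _ (by simp))
  filter_upwards [hline.eventually hnear, self_mem_nhdsWithin] with t ht ht0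
  obtain ⟨q, hq⟩ := closestPoints_nonempty hA (nonempty_of_infDist_pos hz) (z + t • w)
  have hzq : infDist z A ≤ ‖z - q‖ := dist_eq_norm z q ▸ infDist_le_dist_of_mem hq.1
  have hcs : inner ℝ (z + t • w - q) (z - q) ≤ ‖z + t • w - q‖ * ‖z - q‖ :=
    real_inner_le_norm _ _
  rw [add_sub_right_comm, inner_add_left, real_inner_self_eq_norm_sq, real_inner_smul_left,
    ← add_sub_right_comm] at hcs
  have hgain := mul_le_mul_of_nonneg_left (ht q hq).le (mem_Ioi.1 ht0).le
  rw [← hq.2, dist_eq_norm]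
  have : (‖z - q‖ + α' * t) * ‖z - q‖ ≤ ‖z + t • w - q‖ * ‖z - q‖ := by linarith
  linarith [le_of_mul_le_mul_right this (hz.trans_le hzq)]

/-- The point is a maximiser of `z ↦ infDist z A - μ' * dist z x` on the ball, which cannot be
interior since `infDist · A` has an ascent direction of larger slope there. -/
theorem exists_dist_eq_add_mul_le_infDist_of_lt {A : Set E} (hA : IsClosed A) {x : E} {h μ' μ : ℝ}
    (hh : 0 ≤ h) (hx : 0 < infDist x A) (hμ' : 0 ≤ μ') (hμ : μ' < μ)
    (hasc : ∀ z, dist z x < h → 0 < infDist z A → ∃ w : E, ‖w‖ = 1 ∧ IsAscentDir A μ z w) :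
    ∃ z, dist z x = h ∧ infDist x A + μ' * h ≤ infDist z A := by
  have hxmem : x ∈ closedBall x h := mem_closedBall_self hh
  obtain ⟨z, hz, hmax⟩ := (isCompact_closedBall x h).exists_isMaxOn ⟨x, hxmem⟩
    (f := fun z => infDist z A - μ' * dist z x) (by fun_prop)
  have hzx : infDist x A ≤ infDist z A - μ' * dist z x := by simpa using hmax hxmem
  rcases (mem_closedBall.1 hz).lt_or_eq with hlt | heq
  · exfalso
    have hzpos : 0 < infDist z A := by linarith [mul_nonneg hμ' (dist_nonneg (x := z) (y := x))]
    obtain ⟨w, hw, hwz⟩ := hasc z hlt hzpos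
    obtain ⟨μ'', hμ'', hμ''μ⟩ := exists_between hμ
    obtain ⟨t, hgrow, ht, hth⟩ := ((hwz.eventually_add_mul_le_infDist hA hμ''μ hzpos).and
      (Ioo_mem_nhdsGT (sub_pos.2 hlt))).exists
    have hdist : dist (z + t • w) x ≤ t + dist z x := by
      simpa [norm_smul, hw, abs_of_pos ht] using dist_triangle (z + t • w) z x
    have := hmax (mem_closedBall.2 (by linarith : dist (z + t • w) x ≤ h))
    simp only [mem_ofPred_eq] at this
    nlinarith
  · exact ⟨z, heq, by rw [heq] at hzx; linarith⟩

theorem exists_dist_eq_add_mul_le_infDist {A : Set E} (hA : IsClosed A) {x : E} {h μ : ℝ}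
    (hh : 0 ≤ h) (hx : 0 < infDist x A) (hμ : 0 < μ)
    (hasc : ∀ z, dist z x < h → 0 < infDist z A → ∃ w : E, ‖w‖ = 1 ∧ IsAscentDir A μ z w) :
    ∃ z, dist z x = h ∧ infDist x A + μ * h ≤ infDist z A := by
  have hlt : ∀ μ' ∈ Ico 0 μ, ∃ z ∈ sphere x h, infDist x A + μ' * h ≤ infDist z A :=
    fun μ' hμ' => exists_dist_eq_add_mul_le_infDist_of_lt hA hh hx hμ'.1 hμ'.2 hasc
  obtain ⟨z₀, hz₀, -⟩ := hlt 0 ⟨le_rfl, hμ⟩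
  obtain ⟨z, hz, hmax⟩ := (isCompact_sphere x h).exists_isMaxOn ⟨z₀, hz₀⟩
    (continuous_infDist_pt A).continuousOn
  have hlim : Tendsto (fun μ' => infDist x A + μ' * h) (𝓝[<] μ) (𝓝 (infDist x A + μ * h)) :=
    tendsto_nhdsWithin_of_tendsto_nhds (Continuous.tendsto (by fun_prop) μ)
  refine ⟨z, hz, le_of_tendsto hlim ?_⟩
  filter_upwards [Ico_mem_nhdsLT hμ] with μ' hμ'
  obtain ⟨y, hy, hyle⟩ := hlt μ' hμ'
  exact hyle.trans (hmax hy)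

theorem min_add_mul_le_infDist_add_smul {A : Set E} (hA : IsClosed A) {z w : E} {α' α β T : ℝ}
    (hβ : 0 < β) (hα' : 0 ≤ α') (hα : α' < α) (hz : 0 < infDist z A)
    (hasc : ∀ t ∈ Ico 0 T, 0 < infDist (z + t • w) A → infDist (z + t • w) A ≤ β →
      IsAscentDir A α (z + t • w) w) :
    ∀ t ∈ Icc 0 T, min (infDist z A + α' * t) β ≤ infDist (z + t • w) A := by
  have hcont : Continuous fun t : ℝ => infDist (z + t • w) A :=
    (continuous_infDist_pt A).comp (by fun_prop)
  set S : Set ℝ := {t | min (infDist z A + α' * t) β ≤ infDist (z + t • w) A}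
  have hS : IsClosed S := isClosed_le (by fun_prop) hcont
  refine (hS.inter isClosed_Icc).Icc_subset_of_forall_exists_gt (by simp [S]) ?_
  rintro t ⟨ht, htT⟩ y hy
  have hpos : 0 < infDist (z + t • w) A :=
    (lt_min (by linarith [mul_nonneg hα' htT.1]) hβ).trans_le ht
  suffices h : ∀ᶠ s in 𝓝[>] t, s ∈ S from (h.and (Ioc_mem_nhdsGT hy)).exists
  rcases le_or_gt (infDist (z + t • w) A) β with hle | hgt
  · have hgrow := (hasc t htT hpos hle).eventually_add_mul_le_infDist hA hα hpos
    have hshift : Tendsto (fun s => s - t) (𝓝[>] t) (𝓝[>] 0) := by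
      refine tendsto_nhdsWithin_iff.2 ⟨tendsto_nhdsWithin_of_tendsto_nhds
        (Continuous.tendsto' (by fun_prop) _ _ (sub_self t)), ?_⟩
      filter_upwards [self_mem_nhdsWithin] with s hs using sub_pos.2 (mem_Ioi.1 hs)
    filter_upwards [hshift.eventually hgrow, self_mem_nhdsWithin] with s hs hts
    rw [add_assoc, ← add_smul, add_sub_cancel] at hs
    have hnn := mul_nonneg hα' (sub_pos.2 (mem_Ioi.1 hts)).le
    refine le_trans ?_ hs
    rcases min_le_iff.1 (show min (infDist z A + α' * t) β ≤ _ from ht) with h | h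
    · exact (min_le_left _ _).trans (by linarith)
    · exact (min_le_right _ _).trans (by linarith)
  · filter_upwards [nhdsWithin_le_nhds (hcont.continuousAt.eventually (lt_mem_nhds hgt))] with s hs
    exact (min_le_right _ _).trans (le_of_lt hs)

end DistanceFunction

section ProximalNormals

variable {E : Type*} [NormedAddCommGroup E] [InnerProductSpace ℝ E]

/-- The proximal unit normals to `Y` at `p` of radius `τ`: the unit vectors `n` such that the open
ball of radius `τ` tangent to `n` at `p` misses `Y`. -/
def proxNormal (Y : Set E) (τ : ℝ) (p : E) : Set E :=
  {n | ‖n‖ = 1 ∧ ∀ y ∈ Y, τ ≤ dist y (p + τ • n)}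

/-- Uniform prox-regularity of radius `τ`, the form in which positive reach is used: a segment of
length at most `τ` from a point of `Y` to a point projecting to it is along a proximal normal of
radius `τ`. -/
def IsProxRegular (Y : Set E) (τ : ℝ) : Prop :=
  ∀ x, 0 < infDist x Y → infDist x Y ≤ τ →
    ∀ p ∈ closestPoints Y x, (infDist x Y)⁻¹ • (x - p) ∈ proxNormal Y τ p

theorem isClosed_setOf_mem_proxNormal (Y : Set E) (τ : ℝ) :
    IsClosed {q : E × E | q.2 ∈ proxNormal Y τ q.1} := by
  have : {q : E × E | q.2 ∈ proxNormal Y τ q.1} =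
      {q | ‖q.2‖ = 1} ∩ ⋂ y ∈ Y, {q | τ ≤ dist y (q.1 + τ • q.2)} := by
    ext; simp [proxNormal]
  rw [this]
  exact (isClosed_eq (by fun_prop) (by fun_prop)).inter
    (isClosed_biInter fun y _ => isClosed_le (by fun_prop) (by fun_prop))

/-- The ball of radius `infDist x Y` about `x` grows to a ball of radius `τ` about `z`, which can
only be tangent to `Y` at `p` along the same normal. -/
theorem smul_sub_mem_proxNormal_of_dist_eq {Y : Set E} {τ : ℝ} {x z p : E} (hx : 0 < infDist x Y)
    (hp : p ∈ closestPoints Y x) (hzx : dist z x = τ - infDist x Y) (hz : τ ≤ infDist z Y) :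
    (infDist x Y)⁻¹ • (x - p) ∈ proxNormal Y τ p := by
  set D := infDist x Y
  have hxp : ‖x - p‖ = D := by rw [← dist_eq_norm, hp.2]
  have hzx' : ‖z - x‖ = τ - D := by rw [← dist_eq_norm, hzx]
  have hzp : τ ≤ ‖z - x + (x - p)‖ := by
    rw [sub_add_sub_cancel, ← dist_eq_norm]
    exact hz.trans (infDist_le_dist_of_mem hp.1)
  have hray : SameRay ℝ (z - x) (x - p) :=
    sameRay_iff_norm_add.2 (le_antisymm (norm_add_le _ _) (by linarith))
  have hcenter : p + τ • D⁻¹ • (x - p) = z := by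
    have hcol := hray.norm_smul_eq
    rw [hzx', hxp] at hcol
    have : z - x = D⁻¹ • (τ - D) • (x - p) := by rw [hcol, inv_smul_smul₀ hx.ne']
    rw [sub_smul, smul_sub, inv_smul_smul₀ hx.ne', smul_comm] at this
    rw [sub_eq_iff_eq_add.1 this]
    abel
  refine ⟨norm_inv_infDist_smul_sub hx hp, fun y hy => ?_⟩
  rw [hcenter, dist_comm]
  exact hz.trans (infDist_le_dist_of_mem hy)

theorem isProxRegular_of_existsUnique [ProperSpace E] {Y : Set E} (hY : IsClosed Y) {R τ : ℝ}
    (hR : ∀ x, infDist x Y < R → ∃! p, p ∈ closestPoints Y x) (hτR : τ < R) :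
    IsProxRegular Y τ := by
  intro x hx hxτ p hp
  obtain ⟨z, hzx, hz⟩ := exists_dist_eq_add_mul_le_infDist hY (h := τ - infDist x Y)
    (sub_nonneg.2 hxτ) hx one_pos fun z hz hz0 => by
      have : infDist z Y ≤ infDist x Y + dist z x := infDist_le_infDist_add_dist
      exact exists_isAscentDir_one_of_existsUnique hz0 (hR z (by linarith))
  exact smul_sub_mem_proxNormal_of_dist_eq hx hp hzx (by linarith)

theorem norm_smul_add_le {n h : E} {a : ℝ} (ha : 0 < a) (hn : ‖n‖ = 1) :
    ‖a • n + h‖ ≤ a + inner ℝ n h + ‖h‖ ^ 2 / (2 * a) := by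
  have hsq : ‖a • n + h‖ ^ 2 = a ^ 2 + 2 * a * inner ℝ n h + ‖h‖ ^ 2 := by
    rw [norm_add_sq_real, norm_smul, hn, real_inner_smul_left, Real.norm_of_nonneg ha.le]
    ring
  have hrhs : a + inner ℝ n h + ‖h‖ ^ 2 / (2 * a) = (‖a • n + h‖ ^ 2 + a ^ 2) / (2 * a) := by
    rw [hsq]
    field_simp
    ring
  rw [hrhs, le_div_iff₀ (by positivity)]
  nlinarith [sq_nonneg (‖a • n + h‖ - a)]

theorem closedBall_subset_of_mem_proxNormal {X : Set E} (hX : IsClosed X) {τ : ℝ} (hτ : τ ≠ 0)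
    {p n : E} (hn : n ∈ proxNormal (closure Xᶜ) τ p) : closedBall (p + τ • n) τ ⊆ X := by
  rw [← closure_ball _ hτ]
  refine closure_minimal (fun y hy => ?_) hX
  by_contra hyX
  exact (hn.2 y (subset_closure hyX)).not_gt hy

theorem infDist_le_sq_div_of_closedBall_subset {X : Set E} {τ : ℝ} (hτ : 0 < τ) {p n z : E}
    (hn : ‖n‖ = 1) (hB : closedBall (p + τ • n) τ ⊆ X) (hz : 0 ≤ inner ℝ n (z - p)) :
    infDist z X ≤ ‖z - p‖ ^ 2 / (2 * τ) := by
  have hdist : dist (p + τ • n) z ≤ ‖z - p‖ ^ 2 / (2 * τ) + τ := by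
    have hnorm := norm_smul_add_le (h := -(z - p)) hτ hn
    rw [inner_neg_right, norm_neg] at hnorm
    rw [dist_eq_norm, show p + τ • n - z = τ • n + -(z - p) by abel]
    linarith
  obtain ⟨y, hy, hyz⟩ := exists_dist_le_le hτ.le (by positivity) hdist
  rw [dist_comm] at hyz
  exact (infDist_le_dist_of_mem (hB (mem_closedBall'.2 hy))).trans hyz

/-- If `x - z` failed for a point `z` near `x`, then `z` would be quadratically close to `X`, by the
ball tangent at `x`; but `infDist · X` grows linearly from a point `y ∉ X` close to `x`. -/
theorem exists_forall_mem_proxNormal_inner_pos [ProperSpace E] {X : Set E} (hX : IsClosed X)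
    {s μ τ : ℝ} (hs : 0 < s) (hμ : 0 < μ) (hτ : 0 < τ)
    (hasc : ∀ z, 0 < infDist z X → infDist z X ≤ s → ∃ w : E, ‖w‖ = 1 ∧ IsAscentDir X μ z w)
    {x : E} (hx : x ∈ X) (hxY : x ∈ closure Xᶜ) :
    ∃ v : E, ∀ n ∈ proxNormal (closure Xᶜ) τ x, 0 < inner ℝ v n := by
  obtain ⟨h, hpos, hh⟩ : ∃ h > 0, h ≤ min (μ * τ / 2) (s / 2) :=
    ⟨_, lt_min (by positivity) (by positivity), le_rfl⟩
  obtain ⟨hhμ, hhs⟩ := le_min_iff.1 hh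
  obtain ⟨y, hy, hxy⟩ := mem_closure_iff.1 hxY h hpos
  have hy0 : 0 < infDist y X := (hX.notMem_iff_infDist_pos ⟨x, hx⟩).1 hy
  obtain ⟨z, hzy, hz⟩ := exists_dist_eq_add_mul_le_infDist hX hpos.le hy0 hμ fun z hz hz0 => by
    refine hasc z hz0 ((infDist_le_dist_of_mem hx).trans ?_)
    linarith [dist_triangle_right z x y]
  have hzx : ‖z - x‖ ≤ 2 * h := by
    rw [← dist_eq_norm]
    linarith [dist_triangle_right z x y]
  refine ⟨x - z, fun n hn => ?_⟩
  by_contra! hle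
  have hzn : 0 ≤ inner ℝ n (z - x) := by
    rw [real_inner_comm, ← neg_sub x z, inner_neg_left]
    linarith
  have hquad := infDist_le_sq_div_of_closedBall_subset hτ hn.1
    (closedBall_subset_of_mem_proxNormal hX hτ.ne' hn) hzn
  have : ‖z - x‖ ^ 2 / (2 * τ) ≤ μ * h := by
    rw [div_le_iff₀ (by positivity)]
    nlinarith [pow_le_pow_left₀ (norm_nonneg _) hzx 2]
  linarith

theorem eventually_forall_mem_proxNormal_lt_inner [ProperSpace E] {Y : Set E} (hY : IsClosed Y)
    {τ a : ℝ} {v x : E} (hv : x ∈ Y → ∀ n ∈ proxNormal Y τ x, a < inner ℝ v n) :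
    ∀ᶠ q : ℝ × E × E in 𝓝 (a, v, x),
      q.2.2 ∈ Y → ∀ n ∈ proxNormal Y τ q.2.2, q.1 < inner ℝ q.2.1 n := by
  have hloc : ∀ n ∈ sphere (0 : E) 1, ∀ᶠ q : (ℝ × E × E) × E in 𝓝 ((a, v, x), n),
      q.1.2.2 ∈ Y → q.2 ∈ proxNormal Y τ q.1.2.2 → q.1.1 < inner ℝ q.1.2.1 q.2 := by
    intro n _
    by_cases hxn : x ∈ Y ∧ n ∈ proxNormal Y τ x
    · have : ∀ᶠ q : (ℝ × E × E) × E in 𝓝 ((a, v, x), n), q.1.1 < inner ℝ q.1.2.1 q.2 :=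
        ContinuousAt.eventually_lt (by fun_prop) (by fun_prop) (hv hxn.1 n hxn.2)
      filter_upwards [this] with q hq _ _ using hq
    · have hclosed : IsClosed {q : (ℝ × E × E) × E | q.1.2.2 ∈ Y ∧ q.2 ∈ proxNormal Y τ q.1.2.2} :=
        (hY.preimage (f := fun q : (ℝ × E × E) × E => q.1.2.2) (by fun_prop)).inter
          ((isClosed_setOf_mem_proxNormal Y τ).preimage
            (f := fun q : (ℝ × E × E) × E => (q.1.2.2, q.2)) (by fun_prop))
      filter_upwards [hclosed.isOpen_compl.mem_nhds hxn] with q hq hqY hqn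
      exact absurd ⟨hqY, hqn⟩ hq
  filter_upwards [(isCompact_sphere (0 : E) 1).eventually_forall_of_forall_eventually
    (P := fun q n => q.2.2 ∈ Y → n ∈ proxNormal Y τ q.2.2 → q.1 < inner ℝ q.2.1 n) hloc]
    with q hq hqY n hn
  exact hq n (by simpa using hn.1) hqY hn

end ProximalNormals

section ClarkeGradient

variable {E : Type*} [NormedAddCommGroup E] [InnerProductSpace ℝ E] [CompleteSpace E]

theorem hasGradientAt_of_abs_sub_sub_inner_le {φ : E → ℝ} {n x : E} (C : ℝ)
    (h : ∀ y, |φ y - φ x - inner ℝ n (y - x)| ≤ C * ‖y - x‖ ^ 2) : HasGradientAt φ n x := by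
  refine hasGradientAt_iff_isLittleO.2 (Asymptotics.IsBigO.trans_isLittleO ?_
    (Asymptotics.isLittleO_pow_sub_sub x one_lt_two))
  exact Asymptotics.IsBigO.of_bound C <| Eventually.of_forall fun y => by simpa using h y

/-- The triangle inequality through the two ends of the segment from `p` to `p + (a + b) • n`
squeezes the distance between two quadratic perturbations of the same affine function. -/
theorem hasGradientAt_infDist {A : Set E} {n p : E} (hp : p ∈ A) (hn : ‖n‖ = 1) {a b : ℝ}
    (ha : 0 < a) (hb : 0 < b) (hd : infDist (p + (a + b) • n) A = a + b) :
    HasGradientAt (infDist · A) n (p + a • n) := by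
  set x := p + a • n with hx
  have hupper : ∀ y, infDist y A ≤ a + inner ℝ n (y - x) + ‖y - x‖ ^ 2 / (2 * a) := fun y => by
    refine (infDist_le_dist_of_mem hp).trans ?_
    rw [dist_eq_norm, show y - p = a • n + (y - x) by rw [hx]; abel]
    exact norm_smul_add_le ha hn
  have hlower : ∀ y, a + inner ℝ n (y - x) - ‖y - x‖ ^ 2 / (2 * b) ≤ infDist y A := fun y => by
    have hLip : infDist (p + (a + b) • n) A ≤ infDist y A + dist (p + (a + b) • n) y :=
      infDist_le_infDist_add_dist
    have hnorm := norm_smul_add_le (h := -(y - x)) hb hn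
    rw [inner_neg_right, norm_neg,
      show b • n + -(y - x) = p + (a + b) • n - y by rw [hx, add_smul]; abel,
      ← dist_eq_norm] at hnorm
    linarith
  have hxa : infDist x A = a := by
    refine le_antisymm ?_ ?_
    · simpa using hupper x
    · simpa using hlower x
  refine hasGradientAt_of_abs_sub_sub_inner_le (1 / (2 * a) + 1 / (2 * b)) fun y => ?_
  have hane : 0 ≤ ‖y - x‖ ^ 2 / (2 * a) := by positivity
  have hbne : 0 ≤ ‖y - x‖ ^ 2 / (2 * b) := by positivity
  have hsplit : (1 / (2 * a) + 1 / (2 * b)) * ‖y - x‖ ^ 2 =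
      ‖y - x‖ ^ 2 / (2 * a) + ‖y - x‖ ^ 2 / (2 * b) := by ring
  rw [hxa, hsplit, abs_le]
  constructor <;> linarith [hupper y, hlower y]

theorem exists_norm_eq_one_forall_le_inner_of_le_infDist {C : Set E} (hC : Convex ℝ C) {μ : ℝ}
    (hμ : 0 < μ) (h : μ ≤ infDist 0 C) : ∃ w : E, ‖w‖ = 1 ∧ ∀ v ∈ C, μ ≤ inner ℝ w v := by
  have hne : C.Nonempty := nonempty_of_infDist_pos (hμ.trans_le h)
  obtain ⟨u, hu, humin⟩ := exists_norm_eq_iInf_of_complete_convex hne.closure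
    isClosed_closure.isComplete hC.closure 0
  have hobtuse := (norm_eq_iInf_iff_real_inner_le_zero hC.closure hu).1 humin
  have hμu : μ ≤ ‖u‖ := by
    rw [← infDist_closure] at h
    simpa using h.trans (infDist_le_dist_of_mem hu)
  have hupos : 0 < ‖u‖ := hμ.trans_le hμu
  refine ⟨‖u‖⁻¹ • u, by rw [norm_smul, norm_inv, norm_norm, inv_mul_cancel₀ hupos.ne'],
    fun v hv => hμu.trans ?_⟩
  have huv := hobtuse v (subset_closure hv)
  rw [zero_sub, inner_neg_left, inner_sub_right, real_inner_self_eq_norm_sq] at huv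
  rw [real_inner_smul_left, inv_mul_eq_div, le_div_iff₀ hupos, ← sq]
  linarith

variable {d : ℕ} {A X Y : Set (EuclideanSpace ℝ (Fin d))}

/-- The distance is differentiable at the inner points of the segment from `p` to `z`, with
gradient the unit vector of the segment. -/
theorem smul_sub_mem_clarke {z p : EuclideanSpace ℝ (Fin d)} (hz : 0 < infDist z A)
    (hp : p ∈ closestPoints A z) :
    (infDist z A)⁻¹ • (z - p) ∈ clarke (fun y => infDist y A) z := by
  set D := infDist z A
  set n := D⁻¹ • (z - p)
  have hzn : p + D • n = z := by rw [smul_inv_smul₀ hz.ne', add_sub_cancel]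
  obtain ⟨a, -, ha, haD⟩ := exists_seq_strictMono_tendsto' hz
  have hgrad : ∀ k, HasGradientAt (fun y => infDist y A) n (p + a k • n) := fun k =>
    hasGradientAt_infDist hp.1 (norm_inv_infDist_smul_sub hz hp) (ha k).1 (sub_pos.2 (ha k).2)
      (by rw [add_sub_cancel, hzn])
  refine subset_convexHull ℝ _ ⟨fun k => p + a k • n, ?_, fun k => (hgrad k).differentiableAt, ?_⟩
  · simpa only [hzn] using (haD.smul_const n).const_add p
  · simp_rw [fun k => (hgrad k).gradient]
    exact tendsto_const_nhds

theorem exists_isAscentDir_of_le_minNorm_clarke {μ : ℝ} (hμ : 0 < μ)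
    {z : EuclideanSpace ℝ (Fin d)} (hz : 0 < infDist z A)
    (h : μ ≤ minNorm (clarke (fun y => infDist y A) z)) :
    ∃ w : EuclideanSpace ℝ (Fin d), ‖w‖ = 1 ∧ IsAscentDir A μ z w := by
  obtain ⟨w, hw, hwC⟩ :=
    exists_norm_eq_one_forall_le_inner_of_le_infDist (convex_convexHull ℝ _) hμ h
  refine ⟨w, hw, fun p hp => ?_⟩
  have := hwC _ (smul_sub_mem_clarke hz hp)
  rwa [real_inner_smul_right, inv_mul_eq_div, le_div_iff₀ hz] at this

theorem exists_ofReal_lt_of_sSup_pos {S : Set ℝ≥0∞} (h : 0 < sSup S) :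
    ∃ s ∈ S, ∃ r : ℝ, 0 < r ∧ ENNReal.ofReal r < s := by
  obtain ⟨s, hs, hs0⟩ := lt_sSup_iff.1 h
  obtain ⟨r, -, hr, hrs⟩ := ENNReal.lt_iff_exists_real_btwn.1 hs0
  exact ⟨s, hs, r, ENNReal.ofReal_pos.1 hr, hrs⟩

theorem exists_isAscentDir_of_muReach_pos {μ : ℝ} (hμ : 0 < μ)
    (h : 0 < muReach μ X) : ∃ s > 0, ∀ z, 0 < infDist z X → infDist z X ≤ s →
      ∃ w : EuclideanSpace ℝ (Fin d), ‖w‖ = 1 ∧ IsAscentDir X μ z w := by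
  obtain ⟨s, hs, r, hr, hrs⟩ := exists_ofReal_lt_of_sSup_pos h
  refine ⟨r, hr, fun z hz hzr => exists_isAscentDir_of_le_minNorm_clarke hμ hz (hs z ?_ ?_)⟩
  · exact (ENNReal.toReal_pos_iff.1 hz).1
  · rw [← ENNReal.ofReal_toReal (infEDist_ne_top (nonempty_of_infDist_pos hz))]
    exact (ENNReal.ofReal_le_ofReal hzr).trans hrs.le

theorem exists_isProxRegular_of_reach_pos (hY : IsClosed Y) (hne : Y.Nonempty)
    (h : 0 < reach Y) : ∃ τ > 0, IsProxRegular Y τ := by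
  obtain ⟨s, hs, R, hR, hRs⟩ := exists_ofReal_lt_of_sSup_pos h
  have huniq : ∀ x, infDist x Y < R → ∃! p, p ∈ closestPoints Y x := fun x hx => hs x <| by
    rw [← ENNReal.ofReal_toReal (infEDist_ne_top hne)]
    exact (ENNReal.ofReal_le_ofReal hx.le).trans_lt hRs
  exact ⟨R / 2, half_pos hR, isProxRegular_of_existsUnique hY huniq (half_lt_self hR)⟩

end ClarkeGradient

section TransverseField

section

variable {E : Type*} [NormedAddCommGroup E] [InnerProductSpace ℝ E]

theorem inner_nonpos_of_mem_proxNormal_of_mem_posTangentConeAt {Y : Set E} {τ : ℝ} (hτ : 0 < τ)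
    {p n b : E} (hn : n ∈ proxNormal Y τ p) (hb : b ∈ posTangentConeAt Y p) :
    inner ℝ n b ≤ 0 := by
  have hmin : IsLocalMinOn (fun y => ‖y - (p + τ • n)‖ ^ 2) Y p := by
    refine eventually_nhdsWithin_of_forall fun y hy => ?_
    have hp : ‖p - (p + τ • n)‖ = τ := by simp [norm_smul, hn.1, abs_of_pos hτ]
    simpa only [mem_ofPred_eq, hp, dist_eq_norm] using pow_le_pow_left₀ hτ.le (hn.2 y hy) 2
  have hderiv := ((hasFDerivAt_id p).sub_const (p + τ • n)).norm_sq
  have := hmin.hasFDerivWithinAt_nonneg hderiv.hasFDerivWithinAt hb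
  simp only [id_eq, sub_add_cancel_left, map_neg, map_smul, ContinuousLinearMap.comp_id, smul_neg,
    neg_apply, smul_apply, coe_innerSL_apply, smul_eq_mul, nsmul_eq_mul, Nat.cast_ofNat,
    Left.nonneg_neg_iff] at this
  nlinarith

/-- The direction `w` increases the distance to `Y` near `x`, if `x ∈ Y`, and decreases `f` near `x`
if `f x = c`, both to first order. -/
def IsTransverse (Y : Set E) (τ : ℝ) (f : E → ℝ) (c : ℝ) (x w : E) : Prop :=
  (x ∈ Y → ∀ n ∈ proxNormal Y τ x, 0 < inner ℝ w n) ∧ (f x = c → fderiv ℝ f x w < 0)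

theorem exists_forall_inner_pos_and_inner_neg {P : Set E} {v b g : E}
    (hv : ∀ n ∈ P, 0 < inner ℝ v n) (hb : ∀ n ∈ P, inner ℝ n b ≤ 0) (hg : 0 < inner ℝ g b) :
    ∃ w : E, (∀ n ∈ P, 0 < inner ℝ w n) ∧ inner ℝ g w < 0 := by
  obtain ⟨ε, hε, hεg⟩ := exists_pos_mul_lt hg (inner ℝ g v)
  refine ⟨ε • v - b, fun n hn => ?_, ?_⟩
  · rw [inner_sub_left, real_inner_smul_left, real_inner_comm n b]
    linarith [mul_pos hε (hv n hn), hb n hn]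
  · rw [inner_sub_right, real_inner_smul_right]
    linarith

theorem convex_setOf_isTransverse (Y : Set E) (τ : ℝ) (f : E → ℝ) (c : ℝ) (x : E) :
    Convex ℝ {w | IsTransverse Y τ f c x w} := by
  rintro v ⟨hv, hv'⟩ w ⟨hw, hw'⟩ a b ha hb hab
  refine ⟨fun hx n hn => ?_, fun hx => ?_⟩
  · rw [inner_add_left, real_inner_smul_left, real_inner_smul_left]
    exact convex_Ioi (𝕜 := ℝ) (0 : ℝ) (hv hx n hn) (hw hx n hn) ha hb hab
  · rw [map_add, map_smul, map_smul]
    exact convex_Iio (𝕜 := ℝ) (0 : ℝ) (hv' hx) (hw' hx) ha hb hab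

theorem IsTransverse.eventually [ProperSpace E] {Y : Set E} (hY : IsClosed Y) {τ : ℝ} {f : E → ℝ}
    (hf : ContDiff ℝ 1 f) {c : ℝ} {x w : E} (hw : IsTransverse Y τ f c x w) :
    ∀ᶠ y in 𝓝 x, IsTransverse Y τ f c y w := by
  have hnormal : ∀ᶠ y in 𝓝 x, y ∈ Y → ∀ n ∈ proxNormal Y τ y, 0 < inner ℝ w n :=
    (Continuous.tendsto (f := fun y : E => ((0 : ℝ), w, y)) (by fun_prop) x).eventually
      (eventually_forall_mem_proxNormal_lt_inner hY hw.1)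
  have hdescent : ∀ᶠ y in 𝓝 x, f y = c → fderiv ℝ f y w < 0 := by
    have hcont : Continuous fun y => fderiv ℝ f y w :=
      (hf.continuous_fderiv one_ne_zero).clm_apply continuous_const
    by_cases hx : f x = c
    · filter_upwards [hcont.continuousAt.eventually (gt_mem_nhds (hw.2 hx))] with y hy _ using hy
    · filter_upwards [hf.continuous.continuousAt.eventually_ne hx] with y hy h using absurd h hy
  filter_upwards [hnormal, hdescent] with y hy hy' using ⟨hy, hy'⟩

theorem exists_continuous_isTransverse [ProperSpace E] {X Y : Set E} (hX : IsClosed X)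
    (hY : IsClosed Y) {τ : ℝ} {f : E → ℝ} (hf : ContDiff ℝ 1 f) {c : ℝ}
    (h : ∀ x ∈ X, ∃ w, IsTransverse Y τ f c x w) :
    ∃ w : C(E, E), ∀ x ∈ X, IsTransverse Y τ f c x (w x) := by
  refine exists_continuous_forall_mem_convex_of_local_const
    (t := fun x => {w | x ∈ X → IsTransverse Y τ f c x w}) (fun x => ?_) fun x => ?_
  · by_cases hx : x ∈ X
    · simpa only [hx, forall_const] using convex_setOf_isTransverse Y τ f c x
    · simpa only [hx, false_imp_iff, ofPred_true] using convex_univ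
  · by_cases hx : x ∈ X
    · obtain ⟨w, hw⟩ := h x hx
      exact ⟨w, (hw.eventually hY hf).mono fun y hy _ => hy⟩
    · exact ⟨0, mem_of_superset (hX.isOpen_compl.mem_nhds hx) fun y hy h => absurd h hy⟩

end

theorem exists_isTransverse_of_isRegularValue {d : ℕ} {X : Set (EuclideanSpace ℝ (Fin d))}
    {f : EuclideanSpace ℝ (Fin d) → ℝ} {c τ : ℝ} (hτ : 0 < τ) (hc : IsRegularValue f X c)
    {x v : EuclideanSpace ℝ (Fin d)} (hx : x ∈ X)
    (hv : x ∈ cl_compl X → ∀ n ∈ proxNormal (cl_compl X) τ x, 0 < inner ℝ v n) :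
    ∃ w, IsTransverse (cl_compl X) τ f c x w := by
  by_cases hfx : f x = c
  swap
  · exact ⟨v, hv, fun h => absurd h hfx⟩
  have hcrit : -gradient f x ∉ normalCone X x := fun h => hc x hfx ⟨hx, h⟩
  by_cases hxY : x ∈ cl_compl X
  · have hfr : x ∈ frontier X := by
      rw [frontier_eq_closure_inter_closure]
      exact ⟨subset_closure hx, hxY⟩
    simp only [normalCone, if_pos hfr, mem_ofPred_eq, neg_neg, tangentPolar, polarCone,
      not_forall, not_le] at hcrit
    obtain ⟨b, hb, hgb⟩ := hcrit
    obtain ⟨w, hw, hgw⟩ := exists_forall_inner_pos_and_inner_neg (hv hxY)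
      (fun n hn => inner_nonpos_of_mem_proxNormal_of_mem_posTangentConeAt hτ hn hb) hgb
    exact ⟨w, fun _ => hw, fun _ => by rwa [← inner_gradient_left]⟩
  · have hfr : x ∉ frontier X := fun h => hxY (frontier_eq_closure_inter_closure.subset h).2
    rw [normalCone, if_neg hfr, mem_singleton_iff, neg_eq_zero] at hcrit
    refine ⟨-gradient f x, fun h => absurd h hxY, fun _ => ?_⟩
    rw [← inner_gradient_left, inner_neg_right, neg_lt_zero]
    exact real_inner_self_pos.2 hcrit

end TransverseField

section InwardField

theorem eventually_prod_forall_mem_closedBall {V α : Type*} [PseudoMetricSpace V] {v₀ : V}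
    {l : Filter α} {p : V → α → Prop} (h : ∀ᶠ q in 𝓝 v₀ ×ˢ l, p q.1 q.2) :
    ∀ᶠ q in 𝓝[>] (0 : ℝ) ×ˢ l, ∀ v ∈ closedBall v₀ q.1, p v q.2 := by
  obtain ⟨pv, hpv, pa, hpa, hp⟩ := eventually_prod_iff.1 h
  have hball : ∀ᶠ δ in 𝓝[>] (0 : ℝ), ∀ v ∈ closedBall v₀ δ, pv v := nhdsWithin_le_nhds
    ((tendsto_closedBall_smallSets v₀).eventually (eventually_smallSets_forall.2 hpv))
  filter_upwards [hball.prod_mk hpa] with q hq v hv using hp (hq.1 v hv) hq.2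

section Distance

variable {E : Type*} [NormedAddCommGroup E] [InnerProductSpace ℝ E] [ProperSpace E]

theorem eventually_min_add_mul_le_infDist_add_smul {Y : Set E} (hY : IsClosed Y) {τ : ℝ}
    (hτ : 0 < τ) (hprox : IsProxRegular Y τ)
    {w₀ x₀ : E} (hw₀ : x₀ ∈ Y → ∀ n ∈ proxNormal Y τ x₀, 0 < inner ℝ w₀ n) :
    ∀ᶠ q : ℝ × E × E in 𝓝[>] 0 ×ˢ 𝓝 (w₀, x₀), 0 < infDist q.2.2 Y → ∀ t ∈ Icc 0 q.1,
      min (infDist q.2.2 Y + q.1 * t) q.1 ≤ infDist (q.2.2 + t • q.2.1) Y := by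
  obtain ⟨ρ, hρ, hball⟩ :=
    Metric.eventually_nhds_iff.1 (eventually_forall_mem_proxNormal_lt_inner hY hw₀)
  have hreach : ∀ᶠ q : ℝ × E × E in 𝓝 (0, w₀, x₀),
      2 * q.1 < ρ ∧ dist q.2.1 w₀ < ρ ∧ q.1 + q.1 * ‖q.2.1‖ + dist q.2.2 x₀ < ρ := by
    refine .and ?_ (.and ?_ ?_) <;>
      exact ContinuousAt.eventually_lt (by fun_prop) (by fun_prop) (by simpa)
  rw [nhds_prod_eq] at hreach
  filter_upwards [hreach.filter_mono (prod_mono_left _ nhdsWithin_le_nhds),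
    Eventually.prod_inl (Ioc_mem_nhdsGT hτ) _]
  rintro ⟨δ, v, z⟩ ⟨hδρ, hvρ, hzρ⟩ ⟨hδ, hδτ⟩ hz
  refine min_add_mul_le_infDist_add_smul hY (α := 2 * δ) hδ hδ.le (by linarith) hz
    fun t ht hpos hle p hp => ?_
  have hpx : dist p x₀ < ρ := by
    have htri := dist_triangle4 p (z + t • v) z x₀
    have hdist : dist (z + t • v) p = infDist (z + t • v) Y := hp.2
    rw [dist_comm p (z + t • v), hdist, dist_self_add_left, norm_smul,
      Real.norm_of_nonneg ht.1] at htri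
    linarith [mul_le_mul_of_nonneg_right ht.2.le (norm_nonneg v)]
  have hinner := hball (y := (2 * δ, v, p))
    (by simp [Prod.dist_eq, hvρ, hpx, abs_of_pos hδ, hδρ]) hp.1 _
    (hprox _ hpos (hle.trans hδτ) p hp)
  rw [real_inner_smul_right, inv_mul_eq_div, lt_div_iff₀ hpos] at hinner
  exact hinner.le

theorem eventually_min_add_mul_le_infDist_add_smul_of_mem_closure {Y : Set E} (hY : IsClosed Y)
    (hne : Y.Nonempty) {τ : ℝ} (hτ : 0 < τ) (hprox : IsProxRegular Y τ)
    {w : E → E} (hw : Continuous w) {x₀ : E}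
    (hw₀ : x₀ ∈ Y → ∀ n ∈ proxNormal Y τ x₀, 0 < inner ℝ (w x₀) n) :
    ∀ᶠ q : ℝ × E in 𝓝[>] 0 ×ˢ 𝓝 x₀, q.2 ∈ closure Yᶜ → ∀ t ∈ Icc 0 q.1,
      min (infDist q.2 Y + q.1 * t) q.1 ≤ infDist (q.2 + t • w q.2) Y := by
  obtain ⟨pδ, hpδ, pz, hpz, hp⟩ :=
    eventually_prod_iff.1 (eventually_min_add_mul_le_infDist_add_smul hY hτ hprox hw₀)
  have hpx : ∀ᶠ x in 𝓝 x₀, ∀ᶠ z in 𝓝 x, pz (w x, z) :=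
    ((hw.prodMk continuous_id).tendsto x₀).eventually hpz.eventually_nhds |>.mono fun x hx =>
      (Continuous.tendsto (f := fun z => (w x, z)) (by fun_prop) x).eventually hx
  filter_upwards [hpδ.prod_mk hpx]
  rintro ⟨δ, x⟩ ⟨hδ, hx⟩ hxY t ht
  have hclosed : IsClosed {z | min (infDist z Y + δ * t) δ ≤ infDist (z + t • w x) Y} :=
    isClosed_le (by fun_prop) ((continuous_infDist_pt Y).comp (by fun_prop))
  suffices hx : x ∈ {z | min (infDist z Y + δ * t) δ ≤ infDist (z + t • w x) Y} from hx
  refine hclosed.mem_of_frequently_of_tendsto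
    (((mem_closure_iff_frequently.1 hxY).and_eventually hx).mono fun z hz => ?_) tendsto_id
  exact hp hδ hz.2 ((hY.notMem_iff_infDist_pos hne).1 hz.1) t ht

end Distance

section Function

variable {E : Type*} [NormedAddCommGroup E] [NormedSpace ℝ E] {f : E → ℝ} {η w : E → E} {x₀ : E}

theorem exists_eventually_le_sub_mul_of_hasStrictFDerivAt {f' : E →L[ℝ] ℝ}
    (hf : HasStrictFDerivAt f f' x₀) {w₀ : E} (hw₀ : f' w₀ < 0) :
    ∃ m > 0, ∀ᶠ q : ℝ × E × E in 𝓝 (0, x₀, w₀),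
      0 ≤ q.1 → f (q.2.1 + q.1 • q.2.2) ≤ f q.2.1 - m * q.1 := by
  obtain ⟨ε, hε, hεw⟩ := exists_pos_mul_lt (neg_pos.2 hw₀) ‖w₀‖
  obtain ⟨m, hm, hmw⟩ := exists_between (sub_pos.2 hεw)
  have hslope : ∀ᶠ q : ℝ × E × E in 𝓝 (0, x₀, w₀), f' q.2.2 + ‖q.2.2‖ * ε < -m :=
    ContinuousAt.eventually_lt (by fun_prop) (by fun_prop) (by linarith)
  have hends : Tendsto (fun q : ℝ × E × E => (q.2.1 + q.1 • q.2.2, q.2.1)) (𝓝 (0, x₀, w₀))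
      (𝓝 (x₀, x₀)) := Continuous.tendsto' (by fun_prop) _ _ (by simp)
  refine ⟨m, hm, ?_⟩
  filter_upwards [hslope, hends.eventually ((hasStrictFDerivAt_iff_isLittleO.1 hf).def hε)]
    with ⟨t, b, v⟩ hv hb ht
  simp only [add_sub_cancel_left, map_smul, smul_eq_mul, norm_smul, Real.norm_of_nonneg ht] at hb
  linarith [(abs_le.1 hb).2, mul_le_mul_of_nonneg_left hv.le ht]

theorem tendsto_add_inv_smul_smul_sub (hη : LocallyLipschitz η) (hw : Continuous w) :
    Tendsto (fun q : (ℝ × ℝ) × E =>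
      w q.2 + q.1.2⁻¹ • q.1.1 • (η (q.2 + q.1.2 • w q.2) - η q.2))
      (𝓝 ((0, 0), x₀)) (𝓝 (w x₀)) := by
  obtain ⟨K, U, hU, hLip⟩ := hη x₀
  have hbound : Tendsto (fun q : (ℝ × ℝ) × E => |q.1.1| * (K * ‖w q.2‖)) (𝓝 ((0, 0), x₀))
      (𝓝 0) := Continuous.tendsto' (by fun_prop) _ _ (by simp)
  have hx : Tendsto (fun q : (ℝ × ℝ) × E => q.2) (𝓝 ((0, 0), x₀)) (𝓝 x₀) :=
    continuous_snd.tendsto _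
  have hy : Tendsto (fun q : (ℝ × ℝ) × E => q.2 + q.1.2 • w q.2) (𝓝 ((0, 0), x₀)) (𝓝 x₀) :=
    Continuous.tendsto' (by fun_prop) _ _ (by simp)
  rw [← add_zero (w x₀)]
  refine ((hw.tendsto x₀).comp hx).add (squeeze_zero_norm' ?_ hbound)
  filter_upwards [hx.eventually hU, hy.eventually hU] with ⟨⟨s, t⟩, x⟩ hx hy
  have hηxy := hLip.norm_sub_le hy hx
  rw [add_sub_cancel_left, norm_smul] at hηxy
  rw [norm_smul, norm_smul, norm_inv, Real.norm_eq_abs s]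
  calc ‖t‖⁻¹ * (|s| * ‖η (x + t • w x) - η x‖)
      ≤ ‖t‖⁻¹ * (|s| * (K * (‖t‖ * ‖w x‖))) := by gcongr
    _ = ‖t‖⁻¹ * ‖t‖ * (|s| * (K * ‖w x‖)) := by ring
    _ ≤ |s| * (K * ‖w x‖) := mul_le_of_le_one_left (by positivity) inv_mul_le_one

/-- The two displaced points differ by `t • v`, where `v` tends to `w x₀`. -/
theorem exists_eventually_shift_add_smul_le {f' : E →L[ℝ] ℝ} (hf : HasStrictFDerivAt f f' x₀)
    (hη : LocallyLipschitz η) (hw : Continuous w) (hw₀ : f' (w x₀) < 0) :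
    ∃ m > 0, ∀ᶠ q : (ℝ × ℝ) × E in 𝓝 (0, 0) ×ˢ 𝓝 x₀, 0 ≤ q.1.2 →
      f (q.2 + q.1.2 • w q.2 + q.1.1 • η (q.2 + q.1.2 • w q.2)) ≤
        f (q.2 + q.1.1 • η q.2) - m * q.1.2 := by
  have hηc := hη.continuous
  obtain ⟨m, hm, hdec⟩ := exists_eventually_le_sub_mul_of_hasStrictFDerivAt hf hw₀
  have htime : Tendsto (fun q : (ℝ × ℝ) × E => q.1.2) (𝓝 ((0, 0), x₀)) (𝓝 0) :=
    Continuous.tendsto' (by fun_prop) _ _ rfl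
  have hbase : Tendsto (fun q : (ℝ × ℝ) × E => q.2 + q.1.1 • η q.2) (𝓝 ((0, 0), x₀)) (𝓝 x₀) :=
    Continuous.tendsto' (by fun_prop) _ _ (by simp)
  have hdir := tendsto_add_inv_smul_smul_sub (x₀ := x₀) hη hw
  rw [← nhds_prod_eq]
  refine ⟨m, hm, ((htime.prodMk_nhds (hbase.prodMk_nhds hdir)).eventually hdec).mono ?_⟩
  rintro ⟨⟨s, t⟩, x⟩ hq ht
  convert hq ht using 2
  rcases eq_or_ne t 0 with rfl | ht0
  · simp
  · simp only [smul_add, smul_inv_smul₀ ht0, smul_sub]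
    abel

theorem eventually_forall_shift_add_smul_le (hf : ContDiff ℝ 1 f) (hη : LocallyLipschitz η)
    (hw : Continuous w) {c : ℝ} (hw₀ : f x₀ = c → fderiv ℝ f x₀ (w x₀) < 0) :
    ∀ᶠ q : ℝ × E in 𝓝[>] 0 ×ˢ 𝓝 x₀, f q.2 ≤ c + q.1 → ∀ s ∈ Icc 0 q.1, ∀ t ∈ Icc 0 q.1,
      f (q.2 + t • w q.2 + s • η (q.2 + t • w q.2)) ≤ max (f (q.2 + s • η q.2) - q.1 * t) c := by
  have hfc := hf.continuous
  have hηc := hη.continuous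
  have hball : ∀ {δ s t : ℝ}, s ∈ Icc 0 δ → t ∈ Icc 0 δ → (s, t) ∈ closedBall (0, 0) δ :=
    fun hs ht => by simp [Prod.dist_eq, abs_of_nonneg, hs.1, hs.2, ht.1, ht.2]
  rcases lt_trichotomy (f x₀) c with hlt | heq | hgt
  · have hbelow : ∀ᶠ q : (ℝ × ℝ) × E in 𝓝 (0, 0) ×ˢ 𝓝 x₀,
        f (q.2 + q.1.2 • w q.2 + q.1.1 • η (q.2 + q.1.2 • w q.2)) < c := by
      rw [← nhds_prod_eq]
      exact ContinuousAt.eventually_lt (by fun_prop) (by fun_prop) (by simpa)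
    filter_upwards [eventually_prod_forall_mem_closedBall (p := fun (v : ℝ × ℝ) x =>
      f (x + v.2 • w x + v.1 • η (x + v.2 • w x)) < c) hbelow] with q hq _ s hs t ht
    exact (hq _ (hball hs ht)).le.trans (le_max_right _ _)
  · obtain ⟨m, hm, hdec⟩ := exists_eventually_shift_add_smul_le
      (hf.hasStrictFDerivAt one_ne_zero) hη hw (hw₀ heq)
    filter_upwards [eventually_prod_forall_mem_closedBall (p := fun (v : ℝ × ℝ) x => 0 ≤ v.2 →
      f (x + v.2 • w x + v.1 • η (x + v.2 • w x)) ≤ f (x + v.1 • η x) - m * v.2) hdec,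
      Eventually.prod_inl (Ioc_mem_nhdsGT hm) _] with q hq hqm _ s hs t ht
    refine (hq _ (hball hs ht) ht.1).trans (le_max_of_le_left ?_)
    linarith [mul_le_mul_of_nonneg_right hqm.2 ht.1]
  · have habove : ∀ᶠ q : ℝ × E in 𝓝 (0, x₀), c + q.1 < f q.2 :=
      ContinuousAt.eventually_lt (by fun_prop) (by fun_prop) (by simpa)
    rw [nhds_prod_eq] at habove
    filter_upwards [habove.filter_mono (prod_mono_left _ nhdsWithin_le_nhds)] with q hq hle
    exact absurd hle hq.not_ge

theorem eventually_forall_mul_abs_shift_sub_le (hf : LocallyLipschitz f) (hη : Continuous η) :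
    ∀ᶠ q : ℝ × E in 𝓝[>] 0 ×ˢ 𝓝 x₀, ∀ s ∈ Icc 0 q.1, q.1 * |f (q.2 + s • η q.2) - f q.2| ≤ s := by
  obtain ⟨K, U, hU, hLip⟩ := hf x₀
  have hshift : ∀ᶠ q : ℝ × E in 𝓝 0 ×ˢ 𝓝 x₀, q.2 + q.1 • η q.2 ∈ U := by
    rw [← nhds_prod_eq]
    exact (Continuous.tendsto' (by fun_prop) _ _ (by simp)).eventually hU
  have hsmall : ∀ᶠ q : ℝ × E in 𝓝 (0, x₀), q.1 * (K * ‖η q.2‖) < 1 :=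
    ContinuousAt.eventually_lt (by fun_prop) (by fun_prop) (by simp)
  rw [nhds_prod_eq] at hsmall
  filter_upwards [eventually_prod_forall_mem_closedBall (p := fun s x => x + s • η x ∈ U) hshift,
    hsmall.filter_mono (prod_mono_left _ nhdsWithin_le_nhds), Eventually.prod_inr hU _,
    Eventually.prod_inl self_mem_nhdsWithin _] with ⟨δ, x⟩ hxs hδ hx hδ0 s hs
  have hfx := hLip.norm_sub_le (hxs s (by simpa [abs_of_nonneg hs.1] using hs.2)) hx
  rw [add_sub_cancel_left, norm_smul, Real.norm_of_nonneg hs.1, Real.norm_eq_abs] at hfx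
  calc δ * |f (x + s • η x) - f x| ≤ δ * (K * (s * ‖η x‖)) :=
        mul_le_mul_of_nonneg_left hfx (le_of_lt hδ0)
    _ = s * (δ * (K * ‖η x‖)) := by ring
    _ ≤ s := mul_le_of_le_one_right hs.1 hδ.le

end Function

/-- Moving along the vector field `w` for a time `t ≤ δ` drives `x` into the superlevel sets of `D`
and the sublevel sets of all `F s`, `s ≤ δ`, at rate `δ`: `D` grows at this rate until it reaches
`δ`, and `F s` decreases at this rate until it reaches `c`. Moreover `F s x` varies at rate at most
`δ⁻¹` near `s = 0`. A single constant `δ` serves as rate, time bound and level. -/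
structure PushesInward {E : Type*} [AddCommGroup E] [Module ℝ E] (w : E → E) (D : E → ℝ)
    (F : ℝ → E → ℝ) (c δ : ℝ) (x : E) : Prop where
  growth : ∀ t ∈ Icc 0 δ, min (D x + δ * t) δ ≤ D (x + t • w x)
  descent : F 0 x ≤ c + δ → ∀ s ∈ Icc 0 δ, ∀ t ∈ Icc 0 δ,
    F s (x + t • w x) ≤ max (F s x - δ * t) c
  variation : ∀ s ∈ Icc 0 δ, δ * |F s x - F 0 x| ≤ s

namespace PushesInward

variable {E : Type*} [AddCommGroup E] [Module ℝ E] {w : E → E} {D : E → ℝ} {F : ℝ → E → ℝ}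
  {c δ s t : ℝ} {x : E}

theorem le_add_smul (h : PushesInward w D F c δ x) (ht : t ∈ Icc 0 δ) (hsδ : s ≤ δ)
    (hs : s ≤ D x + δ * t) : s ≤ D (x + t • w x) :=
  (le_min hs hsδ).trans (h.growth t ht)

theorem add_smul_le (h : PushesInward w D F c δ x) (ht : t ∈ Icc 0 δ) (hsδ : s ∈ Icc 0 δ)
    (h0 : F 0 x ≤ c + δ) (hs : F s x ≤ c + δ * t) : F s (x + t • w x) ≤ c :=
  (h.descent h0 s hsδ t ht).trans (max_le (sub_le_iff_le_add.2 hs) le_rfl)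

theorem abs_sub_le (h : PushesInward w D F c δ x) (hδ : 0 < δ) (hs : δ * s ∈ Icc 0 δ) :
    |F (δ * s) x - F 0 x| ≤ s :=
  le_of_mul_le_mul_left (h.variation _ hs) hδ

theorem add_smul_mem {X : Set E} (h : PushesInward w D F c δ x) (hD : 0 ≤ D x)
    (hDX : ∀ y, 0 < D y → y ∈ X) (hx : x ∈ X) (ht : t ∈ Icc 0 δ) : x + t • w x ∈ X := by
  rcases ht.1.eq_or_lt with rfl | ht0
  · simpa using hx
  · have hδ : 0 < δ := ht0.trans_le ht.2
    exact hDX _ ((lt_min (add_pos_of_nonneg_of_pos hD (mul_pos hδ ht0)) hδ).trans_le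
      (h.growth t ht))

end PushesInward

theorem exists_pushesInward {E : Type*} [NormedAddCommGroup E] [InnerProductSpace ℝ E]
    [ProperSpace E] {X Y : Set E} (hX : IsCompact X) (hY : IsClosed Y) (hne : Y.Nonempty)
    (hXY : X ⊆ closure Yᶜ) {τ : ℝ} (hτ : 0 < τ) (hprox : IsProxRegular Y τ)
    {f : E → ℝ} (hf : ContDiff ℝ 1 f) {η : E → E} (hη : LocallyLipschitz η) {c : ℝ} {w : E → E}
    (hw : Continuous w) (htrans : ∀ x ∈ X, IsTransverse Y τ f c x (w x)) :
    ∃ δ ∈ Ioo (0 : ℝ) 1, ∀ x ∈ X,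
      PushesInward w (infDist · Y) (fun s y => f (y + s • η y)) c δ x := by
  have hloc : ∀ x₀ ∈ X, {q : ℝ × E | q.2 ∈ X →
      PushesInward w (infDist · Y) (fun s y => f (y + s • η y)) c q.1 q.2} ∈
        𝓝[>] 0 ×ˢ 𝓝 x₀ := fun x₀ hx₀ => by
    filter_upwards [eventually_min_add_mul_le_infDist_add_smul_of_mem_closure hY hne hτ hprox hw
      (htrans x₀ hx₀).1, eventually_forall_shift_add_smul_le hf hη hw (htrans x₀ hx₀).2,
      eventually_forall_mul_abs_shift_sub_le hf.locallyLipschitz hη.continuous]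
      with q hD hdesc hvar hq
    exact ⟨hD (hXY hq), by simpa only [zero_smul, add_zero] using hdesc,
      by simpa only [zero_smul, add_zero] using hvar⟩
  obtain ⟨pδ, hpδ, px, hpx, hp⟩ := eventually_prod_iff.1 (hX.mem_prod_nhdsSet_of_forall hloc)
  obtain ⟨δ, hδ, hδ01⟩ := (hpδ.and (Ioo_mem_nhdsGT one_pos)).exists
  exact ⟨δ, hδ01, fun x hx => hp hδ (hpx.self_of_nhdsSet x hx) hx⟩

end InwardField

section Homotopy

theorem nonempty_homotopyEquiv_of_displacement {E : Type*} [AddCommGroup E] [Module ℝ E]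
    [TopologicalSpace E] [ContinuousAdd E] [ContinuousSMul ℝ E] {w : E → E} (hw : Continuous w)
    {T : ℝ} (hT : 0 ≤ T) {A B : Set E}
    (hA : ∀ x ∈ A, ∀ t ∈ Icc 0 T, x + t • w x ∈ A) (hAB : ∀ x ∈ A, x + T • w x ∈ B)
    (hB : ∀ x ∈ B, ∀ t ∈ Icc 0 T, x + t • w x ∈ B) (hBA : ∀ x ∈ B, x + T • w x ∈ A) :
    Nonempty (ContinuousMap.HomotopyEquiv A B) := by
  have hcomp : ∀ {C C' : Set E}, (∀ x ∈ C, ∀ t ∈ Icc 0 T, x + t • w x ∈ C) →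
      ∀ (hCC' : ∀ x ∈ C, x + T • w x ∈ C') (hC'C : ∀ x ∈ C', x + T • w x ∈ C),
      (ContinuousMap.comp ⟨fun x : C' => (⟨x.1 + T • w x.1, hC'C _ x.2⟩ : C), by fun_prop⟩
        ⟨fun x : C => (⟨x.1 + T • w x.1, hCC' _ x.2⟩ : C'), by fun_prop⟩).Homotopic
        (ContinuousMap.id C) := by
    intro C C' hC hCC' hC'C
    have hmem : ∀ s : unitInterval, (s : ℝ) * T ∈ Icc 0 T := fun s =>
      ⟨mul_nonneg s.2.1 hT, mul_le_of_le_one_left hT s.2.2⟩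
    refine ContinuousMap.Homotopic.symm ⟨⟨⟨fun q : unitInterval × C =>
      (⟨(q.2.1 + ((q.1 : ℝ) * T) • w q.2.1) +
        ((q.1 : ℝ) * T) • w (q.2.1 + ((q.1 : ℝ) * T) • w q.2.1),
        hC _ (hC _ q.2.2 _ (hmem q.1)) _ (hmem q.1)⟩ : C), by fun_prop⟩, fun x => ?_, fun x => ?_⟩⟩
    · ext1; simp
    · ext1; simp
  exact ⟨⟨_, _, hcomp hA hAB hBA, hcomp hB hBA hAB⟩⟩

/-- The time `T` is long enough for `D` to grow by `r = δ ^ 2 * T` and for `F s` to decrease by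
`δ * T = r / δ`, the most by which `F 0` and `F r` can differ. -/
theorem nonempty_homotopyEquiv_of_pushesInward {E : Type*} [AddCommGroup E] [Module ℝ E]
    [TopologicalSpace E] [ContinuousAdd E] [ContinuousSMul ℝ E] {X : Set E} {w : E → E}
    (hw : Continuous w) {D : E → ℝ} (hD : ∀ x, 0 ≤ D x) (hDX : ∀ x, 0 < D x → x ∈ X)
    {F : ℝ → E → ℝ} {c δ T : ℝ} (hδ : δ < 1) (hT : T ∈ Ioo 0 δ)
    (h : ∀ x ∈ X, PushesInward w D F c δ x) :
    Nonempty (ContinuousMap.HomotopyEquiv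
      ({x | δ * (δ * T) ≤ D x} ∩ F (δ * (δ * T)) ⁻¹' Iic c : Set E)
      (X ∩ F 0 ⁻¹' Iic c : Set E)) := by
  obtain ⟨hT0, hTδ⟩ := hT
  have hδ0 : 0 < δ := hT0.trans hTδ
  set r := δ * (δ * T)
  have hr : 0 < r := by positivity
  have hrT : r ≤ δ * T := mul_le_of_le_one_left (by positivity) hδ.le
  have hTle : δ * T ≤ δ := mul_le_of_le_one_right hδ0.le (hTδ.trans hδ).le
  have h0δ : 0 ∈ Icc 0 δ := ⟨le_rfl, hδ0.le⟩
  have hrδ : r ∈ Icc 0 δ := ⟨hr.le, hrT.trans hTle⟩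
  have hmem : ∀ t ∈ Icc 0 T, t ∈ Icc 0 δ := fun t ht => ⟨ht.1, ht.2.trans hTδ.le⟩
  have hTT : T ∈ Icc 0 T := ⟨hT0.le, le_rfl⟩
  have hle : ∀ {a b t : ℝ}, a ≤ b → t ∈ Icc 0 T → a ≤ b + δ * t := fun hab ht =>
    le_add_of_le_of_nonneg hab (mul_nonneg hδ0.le ht.1)
  have hX : ∀ x, r ≤ D x → x ∈ X := fun x hx => hDX x (hr.trans_le hx)
  have hF : ∀ x ∈ X, |F r x - F 0 x| ≤ δ * T := fun x hx => (h x hx).abs_sub_le hδ0 hrδ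
  have hF0 : ∀ x ∈ X, F r x ≤ c → F 0 x ≤ c + δ * T := fun x hx hc => by
    linarith [(abs_le.1 (hF x hx)).1]
  have hFr : ∀ x ∈ X, F 0 x ≤ c → F r x ≤ c + δ * T := fun x hx hc => by
    linarith [(abs_le.1 (hF x hx)).2]
  have hF0δ : ∀ x ∈ X, F r x ≤ c → F 0 x ≤ c + δ := fun x hx hc =>
    (hF0 x hx hc).trans (by gcongr)
  have hgrow : ∀ x, r ≤ D x → ∀ t ∈ Icc 0 T, r ≤ D (x + t • w x) := fun x hx t ht =>
    (h x (hX x hx)).le_add_smul (hmem t ht) hrδ.2 (hle hx ht)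
  have hstay : ∀ x ∈ X, ∀ t ∈ Icc 0 T, x + t • w x ∈ X := fun x hx t ht =>
    (h x hx).add_smul_mem (hD x) hDX hx (hmem t ht)
  refine nonempty_homotopyEquiv_of_displacement hw hT0.le
    (fun x ⟨hxD, hxF⟩ t ht => ⟨hgrow x hxD t ht, ?_⟩)
    (fun x ⟨hxD, hxF⟩ => ⟨hstay x (hX x hxD) T hTT, ?_⟩)
    (fun x ⟨hxX, hxF⟩ t ht => ⟨hstay x hxX t ht, ?_⟩)
    (fun x ⟨hxX, hxF⟩ => ⟨(h x hxX).le_add_smul (hmem T hTT) hrδ.2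
      (le_add_of_nonneg_of_le (hD x) hrT), ?_⟩)
  · exact (h x (hX x hxD)).add_smul_le (hmem t ht) hrδ (hF0δ x (hX x hxD) hxF) (hle hxF ht)
  · exact (h x (hX x hxD)).add_smul_le (hmem T hTT) h0δ (hF0δ x (hX x hxD) hxF)
      (hF0 x (hX x hxD) hxF)
  · exact (h x hxX).add_smul_le (hmem t ht) h0δ (le_add_of_le_of_nonneg hxF hδ0.le) (hle hxF ht)
  · exact (h x hxX).add_smul_le (hmem T hTT) hrδ (le_add_of_le_of_nonneg hxF hδ0.le)
      (hFr x hxX hxF)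

theorem exists_forall_nonempty_homotopyEquiv_of_pushesInward {E : Type*} [AddCommGroup E]
    [Module ℝ E] [TopologicalSpace E] [ContinuousAdd E] [ContinuousSMul ℝ E] {X : Set E}
    {w : E → E} (hw : Continuous w) {D : E → ℝ} (hD : ∀ x, 0 ≤ D x) (hDX : ∀ x, 0 < D x → x ∈ X)
    {F : ℝ → E → ℝ} {c δ : ℝ} (hδ : δ ∈ Ioo (0 : ℝ) 1) (h : ∀ x ∈ X, PushesInward w D F c δ x) :
    ∃ r₀ > 0, ∀ r, 0 < r → r < r₀ → Nonempty (ContinuousMap.HomotopyEquiv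
      ({x | r ≤ D x} ∩ F r ⁻¹' Iic c : Set E) (X ∩ F 0 ⁻¹' Iic c : Set E)) := by
  obtain ⟨hδ0, hδ1⟩ := hδ
  refine ⟨δ * (δ * δ), by positivity, fun r hr hrδ => ?_⟩
  obtain ⟨T, rfl⟩ : ∃ T, r = δ * (δ * T) := ⟨r / δ / δ, by field_simp⟩
  have hT : 0 < T := by simpa only [hδ0, mul_pos_iff_of_pos_left] using hr
  have hTδ : T < δ := by simpa only [hδ0, mul_lt_mul_iff_right₀] using hrδ
  exact nonempty_homotopyEquiv_of_pushesInward hw hD hDX hδ1 ⟨hT, hTδ⟩ h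

end Homotopy

section ComplementaryRegular

variable {d : ℕ} {X : Set (EuclideanSpace ℝ (Fin d))}

theorem mem_counterOffset_iff (hne : (cl_compl X).Nonempty) {r : ℝ}
    {x : EuclideanSpace ℝ (Fin d)} : x ∈ counterOffset X r ↔ r ≤ infDist x (cl_compl X) :=
  ENNReal.ofReal_le_iff_le_toReal (infEDist_ne_top hne)

theorem shifted_zero (f : EuclideanSpace ℝ (Fin d) → ℝ)
    (η : EuclideanSpace ℝ (Fin d) → EuclideanSpace ℝ (Fin d)) : shifted f η 0 = f := by
  ext x
  simp only [shifted, zero_smul, add_zero]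

/-- A compact set with empty complement lives in `ℝ⁰`, where shifting `f` has no effect. -/
theorem sublevel_counterOffset_shifted_of_cl_compl_eq_empty (hX : IsCompact X)
    (hempty : cl_compl X = ∅) (f : EuclideanSpace ℝ (Fin d) → ℝ)
    (η : EuclideanSpace ℝ (Fin d) → EuclideanSpace ℝ (Fin d)) (c r : ℝ) :
    sublevel (counterOffset X r) (shifted f η r) c = sublevel X f c := by
  obtain rfl : X = univ := compl_empty_iff.1 (closure_empty_iff _ |>.1 hempty)
  have hsub : Subsingleton (EuclideanSpace ℝ (Fin d)) := by
    by_contra hnt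
    rw [not_subsingleton_iff_nontrivial] at hnt
    exact (NormedSpace.noncompactSpace ℝ (EuclideanSpace ℝ (Fin d))).1 hX
  have hshift : shifted f η r = f := funext fun x => congrArg f (Subsingleton.elim _ _)
  have hoffset : counterOffset (univ : Set (EuclideanSpace ℝ (Fin d))) r = univ := by
    simp only [counterOffset, hempty, infEDist_empty, le_top, ofPred_true]
  rw [hshift, hoffset]

theorem subset_closure_compl_cl_compl (hX : closure (interior X) = X) :
    X ⊆ closure (cl_compl X)ᶜ := by
  rw [cl_compl, ← interior_eq_compl_closure_compl, hX]

theorem mem_of_infDist_cl_compl_pos {x : EuclideanSpace ℝ (Fin d)}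
    (hx : 0 < infDist x (cl_compl X)) : x ∈ X := by
  by_contra hxX
  exact hx.ne' (infDist_zero_of_mem (subset_closure hxX))

theorem exists_continuous_isTransverse_of_isRegularValue (hX : IsComplementaryRegular X) {τ : ℝ}
    (hτ : 0 < τ) {f : EuclideanSpace ℝ (Fin d) → ℝ} (hf : ContDiff ℝ 1 f) {c : ℝ}
    (hc : IsRegularValue f X c) :
    ∃ w : C(EuclideanSpace ℝ (Fin d), EuclideanSpace ℝ (Fin d)),
      ∀ x ∈ X, IsTransverse (cl_compl X) τ f c x (w x) := by
  obtain ⟨μ, hμ, -, hμX⟩ := hX.muReach_pos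
  obtain ⟨s, hs, hasc⟩ := exists_isAscentDir_of_muReach_pos hμ hμX
  refine exists_continuous_isTransverse hX.isCompact.isClosed isClosed_closure hf fun x hx => ?_
  by_cases hxY : x ∈ cl_compl X
  · obtain ⟨v, hv⟩ := exists_forall_mem_proxNormal_inner_pos hX.isCompact.isClosed hs hμ hτ hasc
      hx hxY
    exact exists_isTransverse_of_isRegularValue hτ hc hx fun _ => hv
  · exact exists_isTransverse_of_isRegularValue hτ hc hx (v := 0) fun hxY' => absurd hxY' hxY

end ComplementaryRegular

end ComplReg

theorem mainTheorem8_general (d : ℕ) (X : Set (EuclideanSpace ℝ (Fin d)))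
    (hX : ComplReg.IsComplementaryRegular X)
    (f : EuclideanSpace ℝ (Fin d) → ℝ) (hf : ContDiff ℝ 1 f)
    (c : ℝ) (hc : ComplReg.IsRegularValue f X c)
    (η : EuclideanSpace ℝ (Fin d) → EuclideanSpace ℝ (Fin d)) (hη : LocallyLipschitz η) :
    ∃ r₀ : ℝ, 0 < r₀ ∧ ∀ r : ℝ, 0 < r → r < r₀ →
      Nonempty (ContinuousMap.HomotopyEquiv
        (ComplReg.sublevel (ComplReg.counterOffset X r) (ComplReg.shifted f η r) c)
        (ComplReg.sublevel X f c)) := by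
  rcases (ComplReg.cl_compl X).eq_empty_or_nonempty with hempty | hne
  · refine ⟨1, one_pos, fun r _ _ => ?_⟩
    rw [ComplReg.sublevel_counterOffset_shifted_of_cl_compl_eq_empty hX.isCompact hempty]
    exact ⟨.refl _⟩
  obtain ⟨τ, hτ, hprox⟩ := ComplReg.exists_isProxRegular_of_reach_pos isClosed_closure hne
    hX.reach_compl_pos
  obtain ⟨w, hw⟩ := ComplReg.exists_continuous_isTransverse_of_isRegularValue hX hτ hf hc
  obtain ⟨δ, hδ, hpush⟩ := ComplReg.exists_pushesInward hX.isCompact isClosed_closure hne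
    (ComplReg.subset_closure_compl_cl_compl hX.closure_interior) hτ hprox hf hη w.continuous hw
  obtain ⟨r₀, hr₀, hequiv⟩ :=
    ComplReg.exists_forall_nonempty_homotopyEquiv_of_pushesInward w.continuous
      (fun _ => Metric.infDist_nonneg) (fun _ => ComplReg.mem_of_infDist_cl_compl_pos) hδ hpush
  refine ⟨r₀, hr₀, fun r hr hrr₀ => ?_⟩
  have hoffset : ComplReg.counterOffset X r = {x | r ≤ Metric.infDist x (ComplReg.cl_compl X)} :=
    ext fun _ => ComplReg.mem_counterOffset_iff hne
  have hsublevel : ComplReg.sublevel X f c =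
      ComplReg.sublevel X (ComplReg.shifted f η 0) c := by rw [ComplReg.shifted_zero]
  rw [hoffset, hsublevel]
  exact hequiv r hr hrr₀

theorem mainTheorem8 (d : ℕ) (X : Set (EuclideanSpace ℝ (Fin d)))
    (hX : ComplReg.IsComplementaryRegular X)
    (f : EuclideanSpace ℝ (Fin d) → ℝ) (hf : ContDiff ℝ 2 f)
    (c : ℝ) (hc : ComplReg.IsRegularValue f X c)
    (η : EuclideanSpace ℝ (Fin d) → EuclideanSpace ℝ (Fin d)) (hη : ContDiff ℝ 2 η)
    (hη_le : ∀ x, ‖η x‖ ≤ 1) :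
    ∃ r₀ : ℝ, 0 < r₀ ∧ ∀ r : ℝ, 0 < r → r < r₀ →
      Nonempty (ContinuousMap.HomotopyEquiv
        (ComplReg.sublevel (ComplReg.counterOffset X r) (ComplReg.shifted f η r) c)
        (ComplReg.sublevel X f c)) :=
  mainTheorem8_general d X hX f (hf.of_le one_le_two) c hc η
    (hη.of_le one_le_two).locallyLipschitz
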